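/- \textbf{Conventions.} For a real matrix $A$ let $\sigma_1(A)\ge\sigma_2(A)\ge\cdots$ be its singular values, $\|A\|_{\mathrm{nuc}}$ their sum and $\|A\|_{\mathrm{op}}=\sigma_1(A)$. A zero-mean random vector $x\in\mathbb R^d$ is sub-Gaussian with parameter $\sigma$ if $\mathbb E\,e^{\lambda\langle v,x\rangle}\le e^{\lambda^2\sigma^2/2}$ for all unit vectors $v$ and all $\lambda\in\mathbb R$. For an $(n+m)\times(n+m)$ covariance matrix $\Sigma$ let $\gamma_{\min}(\Sigma),\gamma_{\max}(\Sigma)$ be its smallest and largest singular values; if $\gamma_{\min}(\Sigma)>0$ put $K_1=\sqrt{\gamma_{\min}(\Sigma)}$, $K_2=\sqrt{\gamma_{\max}(\Sigma)}$, and $s=1$ if $K_1=K_2$, $s=\lfloor (K_2/K_1)^2\rfloor+1$ if $K_1<K_2$. Given $X\in\mathbb R^{N\times n}$, $Z\in\mathbb R^{N\times(n+m)}$, consider the program $$\min_{\Theta\in\mathbb R^{(n+m)\times n}}\|\Theta\|_{\mathrm{nuc}}\quad\text{such that}\quad X=Z\Theta. \qquad (\ast)$$ \textbf{Statement.} For all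 $\sigma,\gamma>0$ there are constants $c_1,c_2>0$, depending only on $\sigma$ and $\gamma$, such that for all $n,m,N,r$ the following two statements hold. (i) Let $Z\in\mathbb R^{N\times(n+m)}$ be a random matrix with i.i.d. zero-mean rows that are sub-Gaussian with parameter $\sigma$ and have covariance matrix $\Sigma$ with $\gamma_{\min}(\Sigma)\ge\gamma$. Let $\Theta^*\in\mathbb R^{(n+m)\times n}$ have rank $r$ and let $X=Z\Theta^*$. If $N\ge c_1(2+3s)(m+n)r$, then with probability at least $1-e^{-c_2N}$ the matrix $\Theta^*$ is the unique optimal solution of $(\ast)$. (ii) Let $A\in\mathbb R^{n\times n}$, $B\in\mathbb R^{n\times m}$ be such that $\Theta^*=[A,B]^T$ has rank $r$, and let $T^0\ge1$. For $i=1,\dots,N$ run the noiseless system $x^{(i)}(t+1)=Ax^{(i)}(t)+Bu^{(i)}(t)$, $x^{(i)}(0)=0$, $0\le t\le T^0-1$, with inputs that are zero-mean sub-Gaussian with parameter $\sigma_u>0$, independent over all $i$ and $t$, and for each $t$ identically distributed over $i$. Let $X$ have the rows $x^{(i)}(T^0)^T$ and $Z$ the rows $z^{(i)}(T^0-1)^T=[x^{(i)}(T^0-1)^T,u^{(i)}(T^0-1)^T]$,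 and let $\Sigma$ be the covariance matrix of $z^{(i)}(T^0-1)$. Suppose that $\gamma_{\min}(\Sigma)\ge\gamma$ and that $\sigma_z:=\big(\sum_{k=0}^{T^0-2}\|A^{T^0-2-k}B\|_{\mathrm{op}}^2\sigma_u^2+\sigma_u^2\big)^{1/2}\le\sigma$. If $N\ge c_1(2+3s)(m+n)r$, then with probability at least $1-e^{-c_2N}$ the matrix $\Theta^*$ is the unique optimal solution of $(\ast)$. -/

import Mathlib

open MeasureTheory ProbabilityTheory Matrix

namespace VARX

noncomputable section

/-- The `k`-th singular value of a real matrix, in decreasing order and counted from `0`. -/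
def singularValue {ι κ : Type} [Fintype ι] [Fintype κ] [DecidableEq κ]
    (A : Matrix ι κ ℝ) (k : ℕ) : ℝ :=
  (Matrix.toEuclideanLin A).singularValues k

/-- Nuclear norm: the sum of the `min d₁ d₂` singular values of a `d₁ × d₂` matrix. -/
def nuclearNorm {ι κ : Type} [Fintype ι] [Fintype κ] [DecidableEq κ]
    (A : Matrix ι κ ℝ) : ℝ :=
  ∑ k ∈ Finset.range (min (Fintype.card ι) (Fintype.card κ)), singularValue A k

/-- Operator norm of a matrix between Euclidean spaces. -/
def opNorm {ι κ : Type} [Fintype ι] [Fintype κ] [DecidableEq κ] (A : Matrix ι κ ℝ) : ℝ :=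
  ‖LinearMap.toContinuousLinearMap (Matrix.toEuclideanLin A)‖

/-- Largest singular value of a square matrix. -/
def gammaMax {ι : Type} [Fintype ι] [DecidableEq ι] (S : Matrix ι ι ℝ) : ℝ :=
  singularValue S 0

/-- Smallest singular value of a square matrix. -/
def gammaMin {ι : Type} [Fintype ι] [DecidableEq ι] (S : Matrix ι ι ℝ) : ℝ :=
  singularValue S (Fintype.card ι - 1)

/-- The integer `s` attached to the weak-isometry constants `K₁ ≤ K₂`:
`s = 1` if `K₁ = K₂`, and `s = ⌊(K₂ / K₁)²⌋ + 1` if `K₁ < K₂`. -/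
def sIndex (K₁ K₂ : ℝ) : ℕ :=
  open scoped Classical in if K₁ = K₂ then 1 else ⌊(K₂ / K₁) ^ 2⌋₊ + 1

/-- `Θ` is an optimal solution of: minimize `‖Θ‖_nuc` subject to `X = Z Θ`. -/
def IsNuclearOptimal {ν ι κ : Type} [Fintype ι] [Fintype κ] [DecidableEq κ]
    (X : Matrix ν κ ℝ) (Z : Matrix ν ι ℝ) (Θ : Matrix ι κ ℝ) : Prop :=
  X = Z * Θ ∧ ∀ Θ' : Matrix ι κ ℝ, X = Z * Θ' → nuclearNorm Θ ≤ nuclearNorm Θ'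

/-- The nuclear-norm program with data `(X, Z)` has `Θ` as its one and only optimal solution. -/
def ExactlyRecovers {ν ι κ : Type} [Fintype ι] [Fintype κ] [DecidableEq κ]
    (X : Matrix ν κ ℝ) (Z : Matrix ν ι ℝ) (Θ : Matrix ι κ ℝ) : Prop :=
  {Θ' : Matrix ι κ ℝ | IsNuclearOptimal X Z Θ'} = {Θ}

/-- A zero-mean random vector `x` is sub-Gaussian with parameter `σ`: for every Euclidean unit
vector `v` and every `t`, `E exp (t ⟨v, x⟩) ≤ exp (t² σ² / 2)`. -/
structure IsSubGaussianVector {Ω : Type*} [MeasurableSpace Ω] {ι : Type} [Fintype ι]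
    (x : Ω → ι → ℝ) (σ : ℝ) (μ : Measure Ω) : Prop where
  measurable : Measurable x
  mean_zero : ∀ i, ∫ ω, x ω i ∂μ = 0
  subgaussian : ∀ v : ι → ℝ, v ⬝ᵥ v = 1 →
    HasSubgaussianMGF (fun ω => v ⬝ᵥ x ω) (Real.toNNReal (σ ^ 2)) μ

/-- Covariance matrix of a random vector. -/
def covMatrix {Ω : Type*} [MeasurableSpace Ω] {ι : Type}
    (x : Ω → ι → ℝ) (μ : Measure Ω) : Matrix ι ι ℝ :=
  Matrix.of fun i j => covariance (fun ω => x ω i) (fun ω => x ω j) μ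

/-- A row-sub-Gaussian random matrix: its rows are i.i.d. sub-Gaussian vectors. -/
structure IsRowSubGaussian {Ω : Type*} [MeasurableSpace Ω] {N : ℕ} {ι : Type} [Fintype ι]
    (Z : Ω → Matrix (Fin N) ι ℝ) (σ : ℝ) (μ : Measure Ω) : Prop where
  subgaussian : ∀ i, IsSubGaussianVector (fun ω => Z ω i) σ μ
  indep : iIndepFun (fun i ω => Z ω i) μ
  identDistrib : ∀ i j, IdentDistrib (fun ω => Z ω i) (fun ω => Z ω j) μ μ

/-- The coefficient matrix `[A, B]ᵀ`. -/
def coeffMatrix {n m : ℕ} (A : Matrix (Fin n) (Fin n) ℝ) (B : Matrix (Fin n) (Fin m) ℝ) :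
    Matrix (Fin n ⊕ Fin m) (Fin n) ℝ :=
  (Matrix.fromCols A B)ᵀ

/-- Noiseless state trajectory: `x(0) = 0`, `x(t+1) = A x(t) + B u(t)`. -/
def state {n m : ℕ} (A : Matrix (Fin n) (Fin n) ℝ) (B : Matrix (Fin n) (Fin m) ℝ)
    (u : ℕ → Fin m → ℝ) : ℕ → Fin n → ℝ
  | 0 => 0
  | t + 1 => A *ᵥ state A B u t + B *ᵥ u t

/-- Response matrix: row `i` is the state `x⁽ⁱ⁾(T+1)` of the `i`-th run. -/
def responseMatrix {n m N : ℕ} (A : Matrix (Fin n) (Fin n) ℝ) (B : Matrix (Fin n) (Fin m) ℝ)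
    (T : ℕ) (u : Fin N → ℕ → Fin m → ℝ) : Matrix (Fin N) (Fin n) ℝ :=
  Matrix.of fun i => state A B (u i) (T + 1)

/-- Measurement matrix: row `i` is `z⁽ⁱ⁾(T) = (x⁽ⁱ⁾(T), u⁽ⁱ⁾(T))` of the `i`-th run. -/
def measurementMatrix {n m N : ℕ} (A : Matrix (Fin n) (Fin n) ℝ)
    (B : Matrix (Fin n) (Fin m) ℝ) (T : ℕ) (u : Fin N → ℕ → Fin m → ℝ) :
    Matrix (Fin N) (Fin n ⊕ Fin m) ℝ :=
  Matrix.of fun i => Sum.elim (state A B (u i) T) (u i T)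

/-- The inputs `u⁽ⁱ⁾(t)`, `t = 0, …, T`, of `N` independent identically designed runs: zero-mean
sub-Gaussian with parameter `σ`, independent over all runs and times, and with the same law in
every run at each time. -/
structure IsExcitation {Ω : Type*} [MeasurableSpace Ω] {N m : ℕ}
    (u : Fin N → ℕ → Ω → Fin m → ℝ) (T : ℕ) (σ : ℝ) (μ : Measure Ω) : Prop where
  subgaussian : ∀ i, ∀ t ≤ T, IsSubGaussianVector (u i t) σ μ
  indep : iIndepFun (fun p : Fin N × Fin (T + 1) => u p.1 p.2) μ
  identDistrib : ∀ i j, ∀ t ≤ T, IdentDistrib (u i t) (u j t) μ μ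

/-- Sub-Gaussian parameter `√(∑_{k<T} ‖Aᵏ B‖² σ² + σ²)` of the rows of the measurement matrix,
for inputs with sub-Gaussian parameter `σ`. -/
def sigmaZ {n m : ℕ} (A : Matrix (Fin n) (Fin n) ℝ) (B : Matrix (Fin n) (Fin m) ℝ)
    (T : ℕ) (σ : ℝ) : ℝ :=
  √(∑ k ∈ Finset.range T, opNorm (A ^ k * B) ^ 2 * σ ^ 2 + σ ^ 2)

end

end VARX

/-! The feasible set, rather than the nuclear norm, decides. If r = 0 then Θ* = 0, the only matrix
of nuclear norm zero. If r ≥ 1, the sample size is at least a constant times d = m + n; then `Z` has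
trivial kernel except with exponentially small probability, and the constraint has a single solution
(`exactlyRecovers_of_forall_mulVec_ne_zero`).

Put p = γ²/(96σ⁴). In a unit direction a row has second moment at least γ and fourth moment at most
96σ⁴, so it avoids any given linear hyperplane with probability at least p
(`measureReal_eq_zero_le`). A nontrivial kernel means that fewer than d rows span all of them; given
those, the others lie independently in a fixed hyperplane, each with probability at most e^{-p}. A
union bound over small sets of rows gives e^{-pN/2} (`measure_exists_mulVec_eq_zero_le`).

For the linear system, the rows of `Z` are linear in the independent inputs, hence sub-Gaussian with
parameter `sigmaZ` and independent across runs, and X = ZΘ* is one step of the recursion. -/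

namespace VARX

/-! ### Nuclear norm and deterministic recovery. -/

lemma singularValue_nonneg {ι κ : Type} [Fintype ι] [Fintype κ] [DecidableEq κ]
    (A : Matrix ι κ ℝ) (k : ℕ) : 0 ≤ singularValue A k :=
  LinearMap.singularValues_nonneg _ k

lemma nuclearNorm_nonneg {ι κ : Type} [Fintype ι] [Fintype κ] [DecidableEq κ]
    (A : Matrix ι κ ℝ) : 0 ≤ nuclearNorm A :=
  Finset.sum_nonneg fun k _ => singularValue_nonneg A k

lemma nuclearNorm_zero {ι κ : Type} [Fintype ι] [Fintype κ] [DecidableEq κ] :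
    nuclearNorm (0 : Matrix ι κ ℝ) = 0 := by
  simp [nuclearNorm, singularValue]

lemma eq_zero_of_nuclearNorm_le_zero {ι κ : Type} [Fintype ι] [Fintype κ] [DecidableEq κ]
    {A : Matrix ι κ ℝ} (h : nuclearNorm A ≤ 0) : A = 0 := by
  by_contra hA
  obtain ⟨i, j, -⟩ : ∃ i j, A i j ≠ 0 := by
    by_contra! hc
    exact hA (Matrix.ext hc)
  have hT : Matrix.toEuclideanLin A ≠ 0 := by simpa using hA
  have hpos : 0 < singularValue A 0 := by
    rw [singularValue, LinearMap.singularValues_pos_iff_lt_finrank_range,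
      Module.finrank_pos_iff_exists_ne_zero]
    obtain ⟨x, hx⟩ := DFunLike.ne_iff.mp hT
    exact ⟨⟨_, x, rfl⟩, fun h0 => hx (by simpa using congrArg Subtype.val h0)⟩
  have hmem : 0 ∈ Finset.range (min (Fintype.card ι) (Fintype.card κ)) := by
    simpa using ⟨Fintype.card_pos_iff.mpr ⟨i⟩, Fintype.card_pos_iff.mpr ⟨j⟩⟩
  exact absurd h (not_le.mpr (hpos.trans_le
    (Finset.single_le_sum (f := singularValue A) (fun k _ => singularValue_nonneg A k) hmem)))

/-- The rank-zero case has to hold for every `Z`, since the sample-size condition is then void. -/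
lemma exactlyRecovers_zero {ν ι κ : Type} [Fintype ι] [Fintype κ] [DecidableEq κ]
    (Z : Matrix ν ι ℝ) : ExactlyRecovers (Z * (0 : Matrix ι κ ℝ)) Z 0 := by
  ext Θ
  simp only [Set.mem_ofPred_eq, Set.mem_singleton_iff]
  constructor
  · rintro ⟨-, hopt⟩
    exact eq_zero_of_nuclearNorm_le_zero (nuclearNorm_zero (ι := ι) (κ := κ) ▸ hopt 0 rfl)
  · rintro rfl
    exact ⟨rfl, fun Θ' _ => nuclearNorm_zero (ι := ι) (κ := κ) ▸ nuclearNorm_nonneg Θ'⟩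

/-- If `Z` has trivial kernel, the program has only one feasible point. -/
lemma exactlyRecovers_of_forall_mulVec_ne_zero {ν ι κ : Type} [Fintype ι] [Fintype κ]
    [DecidableEq κ] (Z : Matrix ν ι ℝ) (Θ : Matrix ι κ ℝ) (hZ : ∀ v, Z *ᵥ v = 0 → v = 0) :
    ExactlyRecovers (Z * Θ) Z Θ := by
  have huniq : ∀ Θ', Z * Θ = Z * Θ' → Θ' = Θ := by
    intro Θ' h
    have h0 : Z * (Θ' - Θ) = 0 := by rw [Matrix.mul_sub, h, sub_self]
    rw [← sub_eq_zero]
    ext i j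
    have := hZ (fun k => (Θ' - Θ) k j) (by ext l; exact congrFun (congrFun h0 l) j)
    exact congrFun this i
  ext Θ'
  simp only [Set.mem_ofPred_eq, Set.mem_singleton_iff]
  constructor
  · exact fun h => huniq Θ' h.1
  · rintro rfl
    exact ⟨rfl, fun Θ'' h => by rw [huniq Θ'' h]⟩

/-! ### Smallest singular value and quadratic form. -/

/-- The quadratic form of a positive semidefinite matrix is bounded below by its smallest
singular value. -/
lemma gammaMin_mul_le_dotProduct_mulVec {ι : Type} [Fintype ι] [DecidableEq ι]
    {S : Matrix ι ι ℝ} (hS : S.PosSemidef) (v : ι → ℝ) :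
    gammaMin S * (v ⬝ᵥ v) ≤ v ⬝ᵥ (S *ᵥ v) := by
  set T := Matrix.toEuclideanLin S with hTdef
  have hT : T.IsSymmetric := Matrix.isSymmetric_toEuclideanLin_iff.mpr hS.isHermitian
  have hquad : ∀ w : EuclideanSpace ℝ ι, inner ℝ w (T w) = w.ofLp ⬝ᵥ (S *ᵥ w.ofLp) := by
    intro w
    simp [hTdef, EuclideanSpace.inner_eq_star_dotProduct, dotProduct_comm,
      Matrix.toLpLin_apply]
  have hcard : Module.finrank ℝ (EuclideanSpace ℝ ι) = Fintype.card ι := by simp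
  set b := hT.eigenvectorBasis hcard
  have hb : ∀ i, gammaMin S ≤ hT.eigenvalues hcard i := by
    intro i
    have hnonneg : 0 ≤ hT.eigenvalues hcard i := by
      have h1 : 0 ≤ inner ℝ (b i) (T (b i)) := by
        rw [hquad]; simpa using hS.dotProduct_mulVec_nonneg (b i).ofLp
      rw [hT.apply_eigenvectorBasis, inner_smul_right] at h1
      simpa [b] using h1
    -- Singular values are defined through T*T, and T* = T, so the squared eigenvalues of T occur in
    -- its spectrum; nonnegativity then allows square roots to be taken.
    have hev : Module.End.HasEigenvalue (LinearMap.adjoint T ∘ₗ T)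
        (hT.eigenvalues hcard i ^ 2) := by
      refine Module.End.hasEigenvalue_of_hasEigenvector (x := b i) ⟨?_, b.orthonormal.ne_zero i⟩
      have hadj : LinearMap.adjoint T = T := (LinearMap.isSymmetric_iff_isSelfAdjoint _).mp hT
      rw [Module.End.mem_eigenspace_iff, hadj]
      simp only [LinearMap.comp_apply, b, hT.apply_eigenvectorBasis, map_smul, smul_smul, sq]
      rfl
    obtain ⟨j, hj⟩ := T.isSymmetric_adjoint_comp_self.exists_eigenvalues_eq hcard hev
    have hlt : Fintype.card ι - 1 < Fintype.card ι := by have := i.2; omega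
    have hle : gammaMin S ^ 2 ≤ hT.eigenvalues hcard i ^ 2 := by
      rw [gammaMin, singularValue, ← hTdef, T.sq_singularValues_of_lt hcard hlt]
      refine (T.isSymmetric_adjoint_comp_self.eigenvalues_antitone hcard
        (show j ≤ ⟨Fintype.card ι - 1, hlt⟩ from ?_)).trans_eq hj
      rw [Fin.le_def]; have := j.2; simp only; omega
    exact le_of_sq_le_sq hle hnonneg
  have hv := hquad (WithLp.toLp 2 v)
  simp only at hv
  rw [← hv, ← b.sum_inner_mul_inner]
  have hvv : v ⬝ᵥ v = ∑ i, inner ℝ (WithLp.toLp 2 v) (b i) * inner ℝ (b i) (WithLp.toLp 2 v) := by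
    rw [b.sum_inner_mul_inner, EuclideanSpace.inner_eq_star_dotProduct]; simp
  rw [hvv, Finset.mul_sum]
  refine Finset.sum_le_sum fun i _ => ?_
  have hTi : inner ℝ (b i) (T (WithLp.toLp 2 v))
      = hT.eigenvalues hcard i * inner ℝ (b i) (WithLp.toLp 2 v) := by
    rw [← hT, hT.apply_eigenvectorBasis, inner_smul_left]; simp [b]
  rw [hTi, real_inner_comm]
  nlinarith [mul_le_mul_of_nonneg_right (hb i) (sq_nonneg (inner ℝ (b i) (WithLp.toLp 2 v)))]

/-! ### Rank deficiency of a matrix with independent rows. -/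

/-- Deficient column rank is witnessed by fewer rows than there are columns. -/
lemma exists_card_lt_forall_mem_span {ν ι : Type} [Fintype ι] {Z : Matrix ν ι ℝ} {v : ι → ℝ}
    (hv : v ≠ 0) (hZ : Z *ᵥ v = 0) :
    ∃ J : Finset ν, J.card < Fintype.card ι ∧
      ∀ i, Z i ∈ Submodule.span ℝ (Set.range fun j : J => Z j) := by
  classical
  obtain ⟨f, hf, hspan, -⟩ := Submodule.exists_fun_fin_finrank_span_eq ℝ (Set.range Z)
  choose g hg using hf
  have hproper : Submodule.span ℝ (Set.range Z) ≠ ⊤ := by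
    intro htop
    have hle : Submodule.span ℝ (Set.range Z) ≤ LinearMap.ker (dotProductBilin ℝ ℝ v) := by
      rw [Submodule.span_le]
      rintro _ ⟨i, rfl⟩
      simpa [Matrix.mulVec, dotProduct_comm v] using congrFun hZ i
    have : v ∈ LinearMap.ker (dotProductBilin ℝ ℝ v) := hle (htop ▸ Submodule.mem_top)
    exact hv (by simpa using this)
  refine ⟨Finset.univ.image g, ?_, fun i => ?_⟩
  · calc (Finset.univ.image g).card ≤ _ := Finset.card_image_le
      _ = Module.finrank ℝ (Submodule.span ℝ (Set.range Z)) := by simp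
      _ < _ := by simpa using Submodule.finrank_lt hproper
  · have h1 : Z i ∈ Submodule.span ℝ (Set.range f) := by
      rw [hspan]; exact Submodule.subset_span ⟨i, rfl⟩
    refine Submodule.span_mono ?_ h1
    rintro _ ⟨k, rfl⟩
    exact ⟨⟨g k, by simp⟩, hg k⟩

/-- The relation "every vector of `b` lies in the span of `a`" is measurable in `(a, b)`. -/
lemma measurableSet_forall_mem_span (α β κ : Type*) [Fintype α] [Fintype β] [Fintype κ] :
    MeasurableSet {x : (α → κ → ℝ) × (β → κ → ℝ) |
      ∀ i, x.2 i ∈ Submodule.span ℝ (Set.range x.1)} := by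
  -- Taking the coefficients as extra variables makes the relation a continuous image of a σ-compact
  -- space, hence a countable union of compact sets.
  let F : (α → κ → ℝ) × (β → α → ℝ) → (α → κ → ℝ) × (β → κ → ℝ) :=
    fun y => (y.1, fun i => ∑ j, y.2 i j • y.1 j)
  have hF : Continuous F := by fun_prop
  have hrange : {x : (α → κ → ℝ) × (β → κ → ℝ) |
      ∀ i, x.2 i ∈ Submodule.span ℝ (Set.range x.1)} = F '' Set.univ := by
    ext ⟨a, b⟩
    simp only [Set.mem_ofPred_eq, Submodule.mem_span_range_iff_exists_fun, Set.image_univ,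
      Set.mem_range]
    constructor
    · intro h
      choose c hc using h
      exact ⟨(a, c), Prod.ext rfl (funext hc)⟩
    · rintro ⟨⟨a', c⟩, h⟩ i
      obtain ⟨rfl, rfl⟩ := Prod.mk.inj h
      exact ⟨c i, rfl⟩
  obtain ⟨K, hK, hKU⟩ := isSigmaCompact_univ.image hF
  rw [hrange, ← hKU]
  exact MeasurableSet.iUnion fun n => (hK n).measurableSet

/-- If no row charges a hyperplane with mass more than `q`, the rows outside `J` all lie in the
span of the too few rows in `J` with probability at most `q` to the number of the former. -/
lemma measure_forall_mem_span_le {Ω : Type*} [MeasurableSpace Ω] {μ : Measure Ω} {N : ℕ}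
    {κ : Type} [Fintype κ] {Y : Fin N → Ω → κ → ℝ} (hY : ∀ i, Measurable (Y i))
    (hind : iIndepFun Y μ) {q : ENNReal}
    (hq : ∀ i, ∀ v : κ → ℝ, v ≠ 0 → μ {ω | v ⬝ᵥ Y i ω = 0} ≤ q)
    (J : Finset (Fin N)) (hJ : J.card < Fintype.card κ) :
    μ {ω | ∀ i : (Jᶜ : Finset (Fin N)), Y i ω ∈ Submodule.span ℝ (Set.range fun j : J => Y j ω)}
      ≤ q ^ Jᶜ.card := by
  have := hind.isProbabilityMeasure
  set f : Ω → J → κ → ℝ := fun ω j => Y j ω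
  set g : Ω → (Jᶜ : Finset (Fin N)) → κ → ℝ := fun ω i => Y i ω
  have hf : Measurable f := by fun_prop
  have hg : Measurable g := by fun_prop
  have hfg : IndepFun f g μ := hind.indepFun_finset J Jᶜ disjoint_compl_right hY
  have hE := measurableSet_forall_mem_span J (Jᶜ : Finset (Fin N)) κ
  set E := {x : (J → κ → ℝ) × ((Jᶜ : Finset (Fin N)) → κ → ℝ) |
      ∀ i, x.2 i ∈ Submodule.span ℝ (Set.range x.1)}
  have : IsProbabilityMeasure (μ.map f) := Measure.isProbabilityMeasure_map hf.aemeasurable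
  have : IsProbabilityMeasure (μ.map g) := Measure.isProbabilityMeasure_map hg.aemeasurable
  -- Independence turns the event into one for a product law; by Fubini it suffices to bound each
  -- slice with the rows in `J` frozen.
  have hmap : μ {ω | ∀ i : (Jᶜ : Finset (Fin N)),
      Y i ω ∈ Submodule.span ℝ (Set.range fun j : J => Y j ω)}
      = ((μ.map f).prod (μ.map g)) E := by
    rw [← hfg.map_prod_eq_prod_map_map hf.aemeasurable hg.aemeasurable,
      Measure.map_apply (hf.prodMk hg) hE]
    rfl
  rw [hmap, Measure.prod_apply hE]
  have hslice : ∀ a : J → κ → ℝ, μ.map g (Prod.mk a ⁻¹' E) ≤ q ^ Jᶜ.card := by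
    intro a
    have hproper : Submodule.span ℝ (Set.range a) < ⊤ := by
      refine lt_top_iff_ne_top.mpr fun htop => ?_
      have h1 := finrank_range_le_card (R := ℝ) a
      rw [Set.finrank, htop, finrank_top] at h1
      simp at h1
      omega
    obtain ⟨φ, hφ, hker⟩ := Submodule.exists_le_ker_of_lt_top _ hproper
    classical
    set v : κ → ℝ := fun k => φ (Pi.single k 1)
    have hφv : ∀ y, φ y = v ⬝ᵥ y := by
      intro y
      conv_lhs => rw [pi_eq_sum_univ' y]
      simp [v, dotProduct, mul_comm]
    have hv : v ≠ 0 := by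
      rintro h0
      exact hφ (LinearMap.ext fun y => by simp [hφv, h0])
    have hmeas : MeasurableSet {y : κ → ℝ | v ⬝ᵥ y = 0} := by
      have : Measurable fun y : κ → ℝ => v ⬝ᵥ y := by unfold dotProduct; fun_prop
      exact this (measurableSet_singleton 0)
    rw [Measure.map_apply hg (measurable_prodMk_left hE)]
    calc μ (g ⁻¹' (Prod.mk a ⁻¹' E))
        ≤ μ (⋂ i ∈ Jᶜ, Y i ⁻¹' {y | v ⬝ᵥ y = 0}) := by
          refine measure_mono fun ω hω => ?_
          simp only [Set.mem_iInter]
          intro i hi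
          have h1 : φ (Y i ω) = 0 := hker (hω ⟨i, hi⟩)
          exact (hφv _).symm.trans h1
      _ = ∏ i ∈ Jᶜ, μ (Y i ⁻¹' {y | v ⬝ᵥ y = 0}) :=
          hind.measure_inter_preimage_eq_mul Jᶜ fun i _ => hmeas
      _ ≤ ∏ i ∈ Jᶜ, q := Finset.prod_le_prod' fun i _ => hq i v hv
      _ = q ^ Jᶜ.card := by simp
  calc ∫⁻ a, μ.map g (Prod.mk a ⁻¹' E) ∂μ.map f ≤ ∫⁻ a, q ^ Jᶜ.card ∂μ.map f :=
        lintegral_mono hslice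
    _ = _ := by simp

/-- A random matrix with `N` independent rows, none of which charges a hyperplane with mass more
than `exp (-p)`, has deficient column rank with exponentially small probability. -/
lemma measure_exists_mulVec_eq_zero_le {Ω : Type*} [MeasurableSpace Ω] {μ : Measure Ω} {N : ℕ}
    {κ : Type} [Fintype κ] {Z : Ω → Matrix (Fin N) κ ℝ} (hY : ∀ i, Measurable fun ω => Z ω i)
    (hind : iIndepFun (fun i ω => Z ω i) μ) {p : ℝ} (hp : 0 < p)
    (hq : ∀ i, ∀ v : κ → ℝ, v ≠ 0 → μ {ω | v ⬝ᵥ Z ω i = 0} ≤ ENNReal.ofReal (Real.exp (-p)))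
    (hN : 4 / p * (p + 4 / p) * Fintype.card κ ≤ N) :
    μ.real {ω | ∃ v, v ≠ 0 ∧ Z ω *ᵥ v = 0} ≤ Real.exp (-(p / 2) * N) := by
  have := hind.isProbabilityMeasure
  set d := Fintype.card κ
  set E : Finset (Fin N) → Set Ω := fun J =>
    {ω | ∀ i : (Jᶜ : Finset (Fin N)), Z ω i ∈ Submodule.span ℝ (Set.range fun j : J => Z ω j)}
  -- The weight (p/4)^|J| makes the union bound a binomial sum, at most e^{pN/4}. Its price is
  -- e^{4|J|/p}, because 4/p ≤ e^{4/p}; with the loss e^{p|J|} this is at most e^{d(p+4/p)}.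
  have hEJ : ∀ J : Finset (Fin N), J.card < d → μ.real (E J) ≤
      (p / 4) ^ J.card * 1 ^ (N - J.card) * Real.exp (-p * N + d * (p + 4 / p)) := by
    intro J hJ
    have h1 := measure_forall_mem_span_le hY hind hq J hJ
    have h2 : μ.real (E J) ≤ Real.exp (-p) ^ Jᶜ.card := by
      refine ENNReal.toReal_le_of_le_ofReal (by positivity) ?_
      rwa [ENNReal.ofReal_pow (Real.exp_pos _).le]
    have hJN : J.card ≤ N := by simpa using J.card_le_univ
    refine h2.trans ?_
    rw [Finset.card_compl, Fintype.card_fin, ← Real.exp_nat_mul, Nat.cast_sub hJN]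
    have h3 : Real.exp (-(J.card * (4 / p))) ≤ (p / 4) ^ J.card := by
      rw [Real.exp_neg, Real.exp_nat_mul, ← inv_pow]
      gcongr
      rw [inv_le_comm₀ (Real.exp_pos _) (by positivity), inv_div]
      linarith [Real.add_one_le_exp (4 / p)]
    calc Real.exp ((N - J.card) * -p)
        ≤ Real.exp (-(J.card * (4 / p)) + (-p * N + d * (p + 4 / p))) := by
          rw [Real.exp_le_exp]
          have : (J.card : ℝ) ≤ d := by exact_mod_cast hJ.le
          nlinarith [mul_le_mul_of_nonneg_right this (by positivity : 0 ≤ p + 4 / p)]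
      _ ≤ _ := by
          rw [Real.exp_add, one_pow, mul_one]; gcongr
  have hsub : {ω | ∃ v, v ≠ 0 ∧ Z ω *ᵥ v = 0} ⊆
      ⋃ J ∈ (Finset.univ : Finset (Finset (Fin N))).filter (·.card < d), E J := by
    rintro ω ⟨v, hv, hZ⟩
    obtain ⟨J, hJ, hspan⟩ := exists_card_lt_forall_mem_span hv hZ
    simp only [Set.mem_iUnion]
    exact ⟨J, by simpa using hJ, fun i => hspan i⟩
  calc μ.real {ω | ∃ v, v ≠ 0 ∧ Z ω *ᵥ v = 0}
      ≤ μ.real (⋃ J ∈ (Finset.univ : Finset (Finset (Fin N))).filter (·.card < d), E J) :=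
        measureReal_mono hsub (measure_ne_top _ _)
    _ ≤ ∑ J ∈ (Finset.univ : Finset (Finset (Fin N))).filter (·.card < d), μ.real (E J) :=
        measureReal_biUnion_finset_le _ _
    _ ≤ ∑ J ∈ (Finset.univ : Finset (Finset (Fin N))).filter (·.card < d),
        (p / 4) ^ J.card * 1 ^ (N - J.card) * Real.exp (-p * N + d * (p + 4 / p)) :=
        Finset.sum_le_sum fun J hJ => hEJ J (by simpa using hJ)
    _ ≤ ∑ J : Finset (Fin N),
        (p / 4) ^ J.card * 1 ^ (N - J.card) * Real.exp (-p * N + d * (p + 4 / p)) :=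
        Finset.sum_le_sum_of_subset_of_nonneg (Finset.filter_subset _ _)
          fun J _ _ => by positivity
    _ = (p / 4 + 1) ^ N * Real.exp (-p * N + d * (p + 4 / p)) := by
        rw [← Finset.sum_mul, ← Fin.sum_pow_mul_eq_add_pow]
    _ ≤ Real.exp (p / 4) ^ N * Real.exp (-p * N + d * (p + 4 / p)) := by
        gcongr; exact Real.add_one_le_exp _
    _ ≤ Real.exp (-(p / 2) * N) := by
        rw [← Real.exp_nat_mul, ← Real.exp_add, Real.exp_le_exp]
        -- The lower bound on N is chosen so that this price costs only another pN/4.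
        have h4 : d * (p + 4 / p) ≤ p / 4 * N := by
          calc d * (p + 4 / p) = p / 4 * (4 / p * (p + 4 / p) * d) := by field_simp
            _ ≤ p / 4 * N := by gcongr
        linarith

/-! ### Moments and non-concentration on hyperplanes. -/

lemma integrable_pow_of_hasSubgaussianMGF {Ω : Type*} [MeasurableSpace Ω] {μ : Measure Ω}
    {Y : Ω → ℝ} {c : NNReal} (hY : HasSubgaussianMGF Y c μ) {k : ℕ} (hk : k ≠ 0) :
    Integrable (fun ω => Y ω ^ k) μ := by
  have h := (hY.memLp (k : NNReal)).integrable_norm_pow (by simpa using hk)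
  refine (integrable_norm_iff (hY.aestronglyMeasurable.pow k)).mp ?_
  simpa using h

/-- The fourth moment of a sub-Gaussian variable. -/
lemma integral_pow_four_le {Ω : Type*} [MeasurableSpace Ω] {μ : Measure Ω} {Y : Ω → ℝ} {σ : ℝ}
    (hσ : 0 < σ) (hY : HasSubgaussianMGF Y (Real.toNNReal (σ ^ 2)) μ) :
    ∫ ω, Y ω ^ 4 ∂μ ≤ 96 * σ ^ 4 := by
  -- This is x⁴/4! ≤ eˣ at x = |y|/σ.
  have hpt : ∀ y : ℝ, y ^ 4 ≤ 24 * σ ^ 4 * (Real.exp (σ⁻¹ * y) + Real.exp (-σ⁻¹ * y)) := by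
    intro y
    have h1 := Real.pow_div_factorial_le_exp (σ⁻¹ * |y|) (by positivity) 4
    have h2 : Real.exp (σ⁻¹ * |y|) ≤ Real.exp (σ⁻¹ * y) + Real.exp (-σ⁻¹ * y) := by
      rcases abs_cases y with h | h <;> rw [h.1]
      · linarith [Real.exp_pos (-σ⁻¹ * y)]
      · rw [mul_neg, ← neg_mul]; linarith [Real.exp_pos (σ⁻¹ * y)]
    have h3 : y ^ 4 = 24 * σ ^ 4 * ((σ⁻¹ * |y|) ^ 4 / (Nat.factorial 4 : ℕ)) := by
      have : |y| ^ 4 = y ^ 4 := by rw [Even.pow_abs (by decide)]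
      rw [mul_pow, this, show Nat.factorial 4 = 24 from rfl]
      field_simp
      norm_num
    rw [h3]
    gcongr
    exact h1.trans h2
  -- At t = ±1/σ the sub-Gaussian bound is √e ≤ 2.
  have hmgf : ∀ t : ℝ, t ^ 2 = (σ ^ 2)⁻¹ → ∫ ω, Real.exp (t * Y ω) ∂μ ≤ 2 := by
    intro t ht
    refine (hY.mgf_le t).trans ?_
    rw [ht, Real.coe_toNNReal _ (sq_nonneg σ), mul_inv_cancel₀ (by positivity)]
    rw [Real.exp_one_rpow _ |>.symm, ← Real.sqrt_eq_rpow]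
    rw [Real.sqrt_le_left (by norm_num)]
    linarith [Real.exp_one_lt_d9]
  have hint := hY.integrable_exp_mul
  calc ∫ ω, Y ω ^ 4 ∂μ
      ≤ ∫ ω, 24 * σ ^ 4 * (Real.exp (σ⁻¹ * Y ω) + Real.exp (-σ⁻¹ * Y ω)) ∂μ :=
        integral_mono (integrable_pow_of_hasSubgaussianMGF hY (by norm_num))
          (((hint _).add (hint _)).const_mul _) fun ω => hpt (Y ω)
    _ = 24 * σ ^ 4 * (∫ ω, Real.exp (σ⁻¹ * Y ω) ∂μ + ∫ ω, Real.exp (-σ⁻¹ * Y ω) ∂μ) := by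
        rw [integral_const_mul, integral_add (hint _) (hint _)]
    _ ≤ 24 * σ ^ 4 * (2 + 2) := by
        gcongr
        · exact hmgf _ (by simp)
        · exact hmgf _ (by simp)
    _ = 96 * σ ^ 4 := by ring

/-- A sub-Gaussian variable with second moment at least `γ` does not concentrate at `0`. -/
lemma measureReal_eq_zero_le {Ω : Type*} [MeasurableSpace Ω] {μ : Measure Ω}
    [IsProbabilityMeasure μ] {Y : Ω → ℝ} {σ γ : ℝ} (hσ : 0 < σ) (hγ : 0 < γ) (hmeas : Measurable Y)
    (hY : HasSubgaussianMGF Y (Real.toNNReal (σ ^ 2)) μ) (hvar : γ ≤ ∫ ω, Y ω ^ 2 ∂μ) :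
    μ.real {ω | Y ω = 0} ≤ 1 - γ ^ 2 / (96 * σ ^ 4) := by
  set M := 96 * σ ^ 4
  have hM : 0 < M := by positivity
  have hE : MeasurableSet {ω | Y ω = 0} := hmeas (measurableSet_singleton 0)
  have h4 := integrable_pow_of_hasSubgaussianMGF hY (k := 4) (by norm_num)
  have hI : Integrable ({ω | Y ω = 0}ᶜ.indicator fun _ => (1 : ℝ)) μ :=
    (integrable_const 1).indicator hE.compl
  -- Off the zero set the defect is a multiple of (Y² - M/γ)². Integrating gives γ ≤ γ/2 + (M/2γ)
  -- P(Y ≠ 0), that is, P(Y ≠ 0) ≥ γ²/M.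
  have hpt : ∀ ω, Y ω ^ 2 ≤ γ / M / 2 * Y ω ^ 4 +
      M / γ / 2 * {ω | Y ω = 0}ᶜ.indicator (fun _ => (1 : ℝ)) ω := by
    intro ω
    by_cases h : Y ω = 0
    · simp [h]
    · have hmem : ω ∈ {ω | Y ω = 0}ᶜ := h
      rw [Set.indicator_of_mem hmem]
      have : γ / M / 2 * Y ω ^ 4 + M / γ / 2 * 1 - Y ω ^ 2
          = γ / M / 2 * (Y ω ^ 2 - M / γ) ^ 2 := by field_simp; ring
      have : 0 ≤ γ / M / 2 * (Y ω ^ 2 - M / γ) ^ 2 := by positivity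
      linarith
  have hle : γ ≤ γ / M / 2 * M + M / γ / 2 * μ.real {ω | Y ω = 0}ᶜ := by
    calc γ ≤ ∫ ω, Y ω ^ 2 ∂μ := hvar
      _ ≤ ∫ ω, (γ / M / 2 * Y ω ^ 4 +
          M / γ / 2 * {ω | Y ω = 0}ᶜ.indicator (fun _ => (1 : ℝ)) ω) ∂μ :=
          integral_mono (integrable_pow_of_hasSubgaussianMGF hY (by norm_num))
            ((h4.const_mul _).add (hI.const_mul _)) hpt
      _ = γ / M / 2 * ∫ ω, Y ω ^ 4 ∂μ + M / γ / 2 * μ.real {ω | Y ω = 0}ᶜ := by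
          rw [integral_add (h4.const_mul _) (hI.const_mul _), integral_const_mul,
            integral_const_mul, integral_indicator_const _ hE.compl]
          simp
      _ ≤ _ := by gcongr; exact integral_pow_four_le hσ hY
  rw [probReal_compl_eq_one_sub hE] at hle
  have h1 : γ / M / 2 * M = γ / 2 := by field_simp
  rw [h1] at hle
  have h2 : γ / 2 * (2 * γ / M) ≤ M / γ / 2 * (1 - μ.real {ω | Y ω = 0}) * (2 * γ / M) :=
    mul_le_mul_of_nonneg_right (by linarith) (by positivity)
  have h3 : M / γ / 2 * (1 - μ.real {ω | Y ω = 0}) * (2 * γ / M)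
      = 1 - μ.real {ω | Y ω = 0} := by field_simp
  have h5 : γ / 2 * (2 * γ / M) = γ ^ 2 / M := by field_simp
  linarith

lemma IsSubGaussianVector.memLp_apply {Ω : Type*} [MeasurableSpace Ω] {μ : Measure Ω} {ι : Type}
    [Fintype ι] {x : Ω → ι → ℝ} {σ : ℝ} (hx : IsSubGaussianVector x σ μ) (i : ι) :
    MemLp (fun ω => x ω i) 2 μ := by
  classical
  have := (hx.subgaussian (Pi.single i 1) (by simp)).memLp 2
  simpa using this

/-- Bilinearity of covariance; it converts the spectral bound on the covariance matrix into a
variance bound in each direction. -/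
lemma covMatrix_dotProduct_mulVec {Ω : Type*} [MeasurableSpace Ω] {μ : Measure Ω}
    [IsProbabilityMeasure μ] {ι : Type} [Fintype ι] {x : Ω → ι → ℝ}
    (hx : ∀ i, MemLp (fun ω => x ω i) 2 μ) (v : ι → ℝ) :
    v ⬝ᵥ (covMatrix x μ *ᵥ v) = variance (fun ω => v ⬝ᵥ x ω) μ := by
  have hvx : ∀ i, MemLp (fun ω => v i * x ω i) 2 μ := fun i => (hx i).const_mul (v i)
  have hm : AEMeasurable (fun ω => v ⬝ᵥ x ω) μ :=
    (memLp_finsetSum Finset.univ fun i _ => hvx i).aestronglyMeasurable.aemeasurable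
  rw [← covariance_self hm]
  simp only [dotProduct]
  rw [covariance_fun_sum_fun_sum hvx hvx]
  simp only [mulVec, dotProduct, covMatrix, Matrix.of_apply, Finset.mul_sum,
    covariance_const_mul_left, covariance_const_mul_right]
  exact Finset.sum_congr rfl fun i _ => Finset.sum_congr rfl fun j _ => by ring

lemma covMatrix_posSemidef {Ω : Type*} [MeasurableSpace Ω] {μ : Measure Ω}
    [IsProbabilityMeasure μ] {ι : Type} [Fintype ι] {x : Ω → ι → ℝ}
    (hx : ∀ i, MemLp (fun ω => x ω i) 2 μ) : (covMatrix x μ).PosSemidef := by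
  refine Matrix.PosSemidef.of_dotProduct_mulVec_nonneg ?_ fun v => ?_
  · ext i j
    simp [covMatrix, covariance_comm]
  · rw [star_trivial, covMatrix_dotProduct_mulVec hx]
    exact variance_nonneg _ _

/-- A sub-Gaussian vector with well-conditioned covariance does not concentrate on a hyperplane. -/
lemma IsSubGaussianVector.measure_dotProduct_eq_zero_le {Ω : Type*} [MeasurableSpace Ω]
    {μ : Measure Ω} [IsProbabilityMeasure μ] {ι : Type} [Fintype ι] [DecidableEq ι]
    {x : Ω → ι → ℝ} {σ γ : ℝ} (hσ : 0 < σ) (hγ : 0 < γ) (hx : IsSubGaussianVector x σ μ)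
    (hcov : γ ≤ gammaMin (covMatrix x μ)) {v : ι → ℝ} (hv : v ≠ 0) :
    μ {ω | v ⬝ᵥ x ω = 0} ≤ ENNReal.ofReal (Real.exp (-(γ ^ 2 / (96 * σ ^ 4)))) := by
  have hvv : 0 < v ⬝ᵥ v := by
    simpa using Matrix.dotProduct_star_self_pos_iff.mpr hv
  set r := (√(v ⬝ᵥ v))⁻¹
  have hr : 0 < r := by positivity
  have hr2 : r * r * (v ⬝ᵥ v) = 1 := by
    rw [← mul_inv, Real.mul_self_sqrt hvv.le, inv_mul_cancel₀ hvv.ne']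
  set w := r • v
  have hw : w ⬝ᵥ w = 1 := by
    simp only [w, smul_dotProduct, dotProduct_smul, smul_eq_mul]; linarith
  have hset : {ω | v ⬝ᵥ x ω = 0} = {ω | w ⬝ᵥ x ω = 0} := by
    ext ω; simp [w, smul_dotProduct, hr.ne']
  have hmeas : Measurable fun ω => w ⬝ᵥ x ω := by
    have := hx.measurable
    unfold dotProduct; fun_prop
  have hmean : ∫ ω, w ⬝ᵥ x ω ∂μ = 0 := by
    simp only [dotProduct]
    rw [integral_finsetSum _ fun i _ => ((hx.memLp_apply i).integrable (by norm_num)).const_mul _]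
    simp [integral_const_mul, hx.mean_zero]
  have hvar : γ ≤ ∫ ω, (w ⬝ᵥ x ω) ^ 2 ∂μ := by
    rw [← variance_of_integral_eq_zero hmeas.aemeasurable hmean,
      ← covMatrix_dotProduct_mulVec hx.memLp_apply]
    have := gammaMin_mul_le_dotProduct_mulVec (covMatrix_posSemidef hx.memLp_apply) w
    rw [hw, mul_one] at this
    exact hcov.trans this
  have h := measureReal_eq_zero_le hσ hγ hmeas (hx.subgaussian w hw) hvar
  rw [hset, ← ENNReal.ofReal_toReal (measure_ne_top μ _)]
  refine ENNReal.ofReal_le_ofReal (h.trans ?_)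
  linarith [Real.add_one_le_exp (-(γ ^ 2 / (96 * σ ^ 4)))]

/-! ### Recovery from independent rows. -/

/-- Exact recovery from independent sub-Gaussian measurement rows. -/
lemma measureReal_not_exactlyRecovers_le {Ω : Type*} [MeasurableSpace Ω] {μ : Measure Ω}
    [IsProbabilityMeasure μ] {N : ℕ} {ι κ : Type} [Fintype ι] [DecidableEq ι] [Fintype κ]
    [DecidableEq κ] {Z : Ω → Matrix (Fin N) ι ℝ} {σ γ p : ℝ} (hσ : 0 < σ) (hγ : 0 < γ)
    (hp : p = γ ^ 2 / (96 * σ ^ 4)) (Θ : Matrix ι κ ℝ)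
    (hZ : ∀ i, IsSubGaussianVector (fun ω => Z ω i) σ μ) (hind : iIndepFun (fun i ω => Z ω i) μ)
    {S : Matrix ι ι ℝ} (hS : ∀ i, covMatrix (fun ω => Z ω i) μ = S) (hmin : γ ≤ gammaMin S)
    {s : ℕ} (hN : 4 / p * (p + 4 / p) * (2 + 3 * (s : ℝ)) * Fintype.card ι * Θ.rank ≤ N) :
    μ.real {ω | ¬ ExactlyRecovers (Z ω * Θ) (Z ω) Θ} ≤ Real.exp (-(p / 2) * N) := by
  have hp0 : 0 < p := by rw [hp]; positivity
  rcases Nat.eq_zero_or_pos Θ.rank with hr | hr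
  · have hΘ : Θ = 0 := by
      rw [Matrix.rank, Submodule.finrank_eq_zero, LinearMap.range_eq_bot] at hr
      ext i j
      simpa using congrFun (DFunLike.congr_fun hr (Pi.single j 1)) i
    have hempty : {ω | ¬ ExactlyRecovers (Z ω * Θ) (Z ω) Θ} = ∅ := by
      rw [Set.eq_empty_iff_forall_notMem]
      intro ω hω
      exact hω (hΘ ▸ exactlyRecovers_zero (Z ω))
    rw [hempty, measureReal_empty]
    positivity
  -- Since r ≥ 1 and 2 + 3s ≥ 1, both factors can be dropped.
  have hN' : 4 / p * (p + 4 / p) * Fintype.card ι ≤ N := by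
    refine le_trans ?_ hN
    have h1 : (1 : ℝ) ≤ Θ.rank := by exact_mod_cast hr
    have h2 : (1 : ℝ) ≤ 2 + 3 * (s : ℝ) := by have : (0 : ℝ) ≤ s := s.cast_nonneg; linarith
    calc 4 / p * (p + 4 / p) * (Fintype.card ι : ℝ)
        = 4 / p * (p + 4 / p) * 1 * Fintype.card ι * 1 := by ring
      _ ≤ _ := by gcongr
  refine le_trans (measureReal_mono ?_ (measure_ne_top _ _))
    (measure_exists_mulVec_eq_zero_le (fun i => (hZ i).measurable) hind hp0 (fun i v hv => ?_) hN')
  · intro ω hω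
    by_contra hc
    refine hω (exactlyRecovers_of_forall_mulVec_ne_zero _ _ fun v hv => ?_)
    by_contra hv0
    exact hc ⟨v, hv0, hv⟩
  · rw [hp]
    exact (hZ i).measure_dotProduct_eq_zero_le hσ hγ (by rwa [hS i]) hv

/-! ### Linear images of sub-Gaussian vectors and the state recursion. -/

lemma hasSubgaussianMGF_mono {Ω : Type*} [MeasurableSpace Ω] {μ : Measure Ω} {Y : Ω → ℝ}
    {c c' : NNReal} (hY : HasSubgaussianMGF Y c μ) (h : c ≤ c') : HasSubgaussianMGF Y c' μ where
  integrable_exp_mul := hY.integrable_exp_mul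
  mgf_le t := (hY.mgf_le t).trans (by gcongr)

lemma IsSubGaussianVector.hasSubgaussianMGF_dotProduct {Ω : Type*} [MeasurableSpace Ω]
    {μ : Measure Ω} [IsProbabilityMeasure μ] {ι : Type} [Fintype ι] {x : Ω → ι → ℝ} {σ : ℝ}
    (hx : IsSubGaussianVector x σ μ) (w : ι → ℝ) :
    HasSubgaussianMGF (fun ω => w ⬝ᵥ x ω) (Real.toNNReal (w ⬝ᵥ w * σ ^ 2)) μ := by
  by_cases hw : w = 0
  · subst hw; simp
  have hww : 0 < w ⬝ᵥ w := by
    simpa using Matrix.dotProduct_star_self_pos_iff.mpr hw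
  set r := √(w ⬝ᵥ w)
  have hr : 0 < r := by positivity
  have hr2 : r * r = w ⬝ᵥ w := Real.mul_self_sqrt hww.le
  have hunit : (r⁻¹ • w) ⬝ᵥ (r⁻¹ • w) = 1 := by
    simp only [smul_dotProduct, dotProduct_smul, smul_eq_mul, ← hr2]
    field_simp
  have h := (hx.subgaussian _ hunit).const_mul r
  convert h using 1
  · ext ω
    simp only [smul_dotProduct, smul_eq_mul]
    field_simp
  · rw [← hr2, Real.toNNReal_mul (by positivity)]
    congr 1
    ext
    rw [Real.coe_toNNReal _ (by positivity)]
    exact (sq r).symm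

lemma zero_le_dotProduct_self {ι : Type*} [Fintype ι] (y : ι → ℝ) : 0 ≤ y ⬝ᵥ y :=
  Finset.sum_nonneg fun k _ => mul_self_nonneg (y k)

/-- A matrix contracts row vectors by at most its operator norm. -/
lemma vecMul_dotProduct_vecMul_le {ι κ : Type} [Fintype ι] [Fintype κ] [DecidableEq κ]
    (M : Matrix ι κ ℝ) (a : ι → ℝ) :
    (a ᵥ* M) ⬝ᵥ (a ᵥ* M) ≤ opNorm M ^ 2 * (a ⬝ᵥ a) := by
  set w := a ᵥ* M
  -- Cauchy–Schwarz for |w|² = ⟨a, Mw⟩ brings in M itself, so the norm of the transpose is never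
  -- needed.
  have hcs : (w ⬝ᵥ w) ^ 2 ≤ (a ⬝ᵥ a) * ((M *ᵥ w) ⬝ᵥ (M *ᵥ w)) := by
    have h1 : w ⬝ᵥ w = a ⬝ᵥ (M *ᵥ w) := (Matrix.dotProduct_mulVec a M w).symm
    rw [h1]
    simpa [dotProduct, sq] using Finset.sum_mul_sq_le_sq_mul_sq Finset.univ a (M *ᵥ w)
  have hop : (M *ᵥ w) ⬝ᵥ (M *ᵥ w) ≤ opNorm M ^ 2 * (w ⬝ᵥ w) := by
    have hnorm : ∀ {α : Type} [Fintype α] (y : α → ℝ), ‖WithLp.toLp 2 y‖ ^ 2 = y ⬝ᵥ y := by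
      intro α _ y
      rw [EuclideanSpace.norm_sq_eq]
      simp [dotProduct, sq]
    have h2 := (LinearMap.toContinuousLinearMap (Matrix.toEuclideanLin M)).le_opNorm
      (WithLp.toLp 2 w)
    rw [← hnorm, ← hnorm, ← mul_pow]
    gcongr
    simpa [opNorm, Matrix.toLpLin_apply] using h2
  by_cases hw : w ⬝ᵥ w = 0
  · rw [hw]
    exact mul_nonneg (sq_nonneg _) (zero_le_dotProduct_self a)
  · have hpos : 0 < w ⬝ᵥ w := lt_of_le_of_ne (zero_le_dotProduct_self w) (Ne.symm hw)
    refine le_of_mul_le_mul_right ?_ hpos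
    calc w ⬝ᵥ w * (w ⬝ᵥ w) = (w ⬝ᵥ w) ^ 2 := by ring
      _ ≤ (a ⬝ᵥ a) * (opNorm M ^ 2 * (w ⬝ᵥ w)) :=
          hcs.trans (mul_le_mul_of_nonneg_left hop (zero_le_dotProduct_self a))
      _ = _ := by ring

/-- The state as a convolution of the inputs with the impulse response. -/
lemma dotProduct_state {n m : ℕ} (A : Matrix (Fin n) (Fin n) ℝ) (B : Matrix (Fin n) (Fin m) ℝ)
    (u : ℕ → Fin m → ℝ) (T : ℕ) (a : Fin n → ℝ) :
    a ⬝ᵥ state A B u T = ∑ k ∈ Finset.range T, (a ᵥ* (A ^ (T - 1 - k) * B)) ⬝ᵥ u k := by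
  induction T generalizing a with
  | zero => simp [state]
  | succ T ih =>
    rw [state, dotProduct_add, Matrix.dotProduct_mulVec, Matrix.dotProduct_mulVec, ih,
      Finset.sum_range_succ]
    congr 1
    · refine Finset.sum_congr rfl fun k hk => ?_
      have : T + 1 - 1 - k = (T - 1 - k) + 1 := by
        have := Finset.mem_range.mp hk; omega
      rw [this, pow_succ', Matrix.vecMul_vecMul, Matrix.mul_assoc]
    · simp

/-- Causality: inputs from time T on may be altered freely, so the finitely many random inputs
determine the state. -/
lemma state_congr {n m : ℕ} (A : Matrix (Fin n) (Fin n) ℝ) (B : Matrix (Fin n) (Fin m) ℝ)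
    {u u' : ℕ → Fin m → ℝ} {T : ℕ} (h : ∀ t < T, u t = u' t) :
    state A B u T = state A B u' T := by
  induction T with
  | zero => rfl
  | succ T ih => rw [state, state, ih fun t ht => h t (by omega), h T (by omega)]

lemma continuous_state {n m : ℕ} (A : Matrix (Fin n) (Fin n) ℝ) (B : Matrix (Fin n) (Fin m) ℝ)
    {α : Type*} [TopologicalSpace α] {u : α → ℕ → Fin m → ℝ} {T : ℕ}
    (h : ∀ t, Continuous fun x => u x t) : Continuous fun x => state A B (u x) T := by
  induction T with
  | zero => exact continuous_const
  | succ T ih =>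
    have := h T
    simp only [state]
    fun_prop

lemma responseMatrix_eq {n m N : ℕ} (A : Matrix (Fin n) (Fin n) ℝ)
    (B : Matrix (Fin n) (Fin m) ℝ) (T : ℕ) (u : Fin N → ℕ → Fin m → ℝ) :
    responseMatrix A B T u = measurementMatrix A B T u * coeffMatrix A B := by
  ext i j
  simp [responseMatrix, measurementMatrix, coeffMatrix, state, Matrix.mul_apply, mulVec,
    dotProduct, Matrix.fromCols, mul_comm]

/-! ### Independence and sub-Gaussianity of the measurement rows. -/

/-- Grouping an independent family indexed by pairs along the first index. -/
lemma iIndepFun_curry {Ω : Type*} [MeasurableSpace Ω] {μ : Measure Ω} {ι κ X : Type*}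
    [MeasurableSpace X] {f : ι → κ → Ω → X} (hf : ∀ i j, Measurable (f i j))
    (hind : iIndepFun (fun p : ι × κ => f p.1 p.2) μ) :
    iIndepFun (fun i ω j => f i j ω) μ := by
  have := hind.isProbabilityMeasure
  have : ∀ i j, IsProbabilityMeasure (μ.map (f i j)) :=
    fun i j => Measure.isProbabilityMeasure_map (hf i j).aemeasurable
  have hrow : ∀ i, iIndepFun (f i) μ := fun i =>
    hind.precomp (g := fun j : κ => (i, j)) fun j j' h => (Prod.mk.inj h).2
  rw [iIndepFun_iff_map_fun_eq_infinitePi_map fun i => measurable_pi_lambda _ (hf i)]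
  have hrow' : ∀ i, μ.map (fun ω j => f i j ω) = Measure.infinitePi fun j => μ.map (f i j) :=
    fun i => (hrow i).map_fun_eq_infinitePi_map (hf i)
  have hpair := hind.map_fun_eq_infinitePi_map fun p : ι × κ => hf p.1 p.2
  simp_rw [hrow']
  -- Independence is a product form of the joint law, and currying carries the product over pairs to
  -- the iterated product.
  rw [← Measure.infinitePi_map_curry (fun i j => μ.map (f i j)),
    ← hpair,
    Measure.map_map (by fun_prop) (measurable_pi_lambda _ fun p : ι × κ => hf p.1 p.2)]
  rfl

section Excitation

variable {Ω : Type*} [MeasurableSpace Ω] {μ : Measure Ω} {n m N T : ℕ}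
  {u : Fin N → ℕ → Ω → Fin m → ℝ} {σ : ℝ}

lemma IsExcitation.iIndepFun_measurementMatrix (hu : IsExcitation u T σ μ)
    (A : Matrix (Fin n) (Fin n) ℝ) (B : Matrix (Fin n) (Fin m) ℝ) :
    iIndepFun (fun i ω => measurementMatrix A B T (fun j t => u j t ω) i) μ := by
  have h := iIndepFun_curry (f := fun i (t : Fin (T + 1)) => u i t)
    (fun i t => (hu.subgaussian i t (Nat.lt_succ_iff.mp t.2)).measurable) hu.indep
  -- Extending by zero makes each row a fixed continuous function of its finite block of inputs.
  let e : (Fin (T + 1) → Fin m → ℝ) → ℕ → Fin m → ℝ :=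
    fun y t => if ht : t < T + 1 then y ⟨t, ht⟩ else 0
  have he : ∀ t, Continuous fun y => e y t := by
    intro t
    by_cases ht : t < T + 1 <;> simp only [e, ht, dite_true, dite_false] <;> fun_prop
  let F : (Fin (T + 1) → Fin m → ℝ) → Fin n ⊕ Fin m → ℝ :=
    fun y => Sum.elim (state A B (e y) T) (e y T)
  have hF : Continuous F := by
    have h1 := continuous_state A B (T := T) he
    have h2 := he T
    refine continuous_pi fun k => ?_
    cases k with
    | inl k => exact (continuous_apply k).comp h1
    | inr k => exact (continuous_apply k).comp h2
  have hcomp := h.comp (fun _ => F) fun _ => hF.measurable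
  convert hcomp using 2 with i
  ext ω k
  have hst : state A B (fun t => u i t ω) T
      = state A B (e fun t : Fin (T + 1) => u i t ω) T :=
    state_congr A B fun t ht => by simp only [e, dif_pos (show t < T + 1 by omega)]
  cases k <;> simp [measurementMatrix, F, hst, e]

lemma IsExcitation.integrable_and_integral_state [IsProbabilityMeasure μ]
    (hu : IsExcitation u T σ μ)
    (A : Matrix (Fin n) (Fin n) ℝ) (B : Matrix (Fin n) (Fin m) ℝ) (i : Fin N) {t : ℕ}
    (ht : t ≤ T) (k : Fin n) :
    Integrable (fun ω => state A B (fun t => u i t ω) t k) μ ∧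
      ∫ ω, state A B (fun t => u i t ω) t k ∂μ = 0 := by
  induction t generalizing k with
  | zero => simp [state]
  | succ t ih =>
    have ih' := fun l => ih (by omega) l
    have hut := hu.subgaussian i t (by omega)
    have hui : ∀ l, Integrable (fun ω => u i t ω l) μ :=
      fun l => (hut.memLp_apply l).integrable (by norm_num)
    have hA : ∀ l ∈ Finset.univ,
        Integrable (fun ω => A k l * state A B (fun t => u i t ω) t l) μ :=
      fun l _ => (ih' l).1.const_mul _
    have hB : ∀ l ∈ Finset.univ, Integrable (fun ω => B k l * u i t ω l) μ :=
      fun l _ => (hui l).const_mul _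
    simp only [state, Pi.add_apply, mulVec, dotProduct]
    refine ⟨(integrable_finsetSum _ hA).add (integrable_finsetSum _ hB), ?_⟩
    rw [integral_add (integrable_finsetSum _ hA) (integrable_finsetSum _ hB),
      integral_finsetSum _ hA, integral_finsetSum _ hB]
    simp [integral_const_mul, (ih' _).2, hut.mean_zero]

lemma IsExcitation.isSubGaussianVector_measurementMatrix [IsProbabilityMeasure μ]
    (hu : IsExcitation u T σ μ)
    (A : Matrix (Fin n) (Fin n) ℝ) (B : Matrix (Fin n) (Fin m) ℝ) {τ : ℝ}
    (hτ : sigmaZ A B T σ ≤ τ) (i : Fin N) :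
    IsSubGaussianVector (fun ω => measurementMatrix A B T (fun j t => u j t ω) i) τ μ where
  measurable := by
    refine measurable_pi_iff.mpr fun k => ?_
    cases k with
    | inl k =>
      have hst : ∀ t ≤ T, Measurable fun ω => state A B (fun t => u i t ω) t := by
        intro t ht
        induction t with
        | zero => exact measurable_const
        | succ t ih =>
          have h1 := ih (by omega)
          have h2 := (hu.subgaussian i t (by omega)).measurable
          simp only [state]
          refine Measurable.add ?_ ?_ <;>
            · refine measurable_pi_iff.mpr fun l => ?_
              simp only [mulVec, dotProduct]
              fun_prop
      exact measurable_pi_iff.mp (hst T le_rfl) k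
    | inr k => exact measurable_pi_iff.mp (hu.subgaussian i T le_rfl).measurable k
  mean_zero k := by
    cases k with
    | inl k => exact (hu.integrable_and_integral_state A B i le_rfl k).2
    | inr k => exact (hu.subgaussian i T le_rfl).mean_zero k
  subgaussian v hv := by
    set a : Fin n → ℝ := fun k => v (Sum.inl k)
    set b : Fin m → ℝ := fun k => v (Sum.inr k)
    have hab : a ⬝ᵥ a + b ⬝ᵥ b = 1 := by
      rw [← hv]; simp [dotProduct, a, b]
    have ha := zero_le_dotProduct_self a
    have hb := zero_le_dotProduct_self b
    -- The row's component along v = (a, b) is a sum over time: the input at t < T enters through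
    -- the impulse response paired with `a`, the one at T directly through `b`.
    let w : ℕ → Fin m → ℝ := fun t => if t < T then a ᵥ* (A ^ (T - 1 - t) * B) else b
    let c : ℕ → ℝ := fun t => w t ⬝ᵥ w t * σ ^ 2
    have hind : iIndepFun (fun (t : Fin (T + 1)) ω => w t ⬝ᵥ u i t ω) μ := by
      have h1 : iIndepFun (fun (t : Fin (T + 1)) => u i t) μ :=
        hu.indep.precomp (g := fun t => (i, t)) fun t t' h => (Prod.mk.inj h).2
      refine h1.comp (fun t y => w t ⬝ᵥ y) fun t => ?_
      unfold dotProduct; fun_prop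
    have hsum := HasSubgaussianMGF.sum_of_iIndepFun hind (s := Finset.univ)
      (c := fun t => Real.toNNReal (c t)) fun t _ =>
        (hu.subgaussian i t (Nat.lt_succ_iff.mp t.2)).hasSubgaussianMGF_dotProduct (w t)
    have hfun : (fun ω => v ⬝ᵥ measurementMatrix A B T (fun j t => u j t ω) i)
        = fun ω => ∑ t : Fin (T + 1), w t ⬝ᵥ u i t ω := by
      ext ω
      have h1 : v ⬝ᵥ measurementMatrix A B T (fun j t => u j t ω) i
          = a ⬝ᵥ state A B (fun t => u i t ω) T + b ⬝ᵥ u i T ω := by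
        simp [dotProduct, measurementMatrix, a, b]
      rw [h1, dotProduct_state, Fin.sum_univ_eq_sum_range (fun t => w t ⬝ᵥ u i t ω),
        Finset.sum_range_succ]
      congr 1
      · exact Finset.sum_congr rfl fun t ht => by simp [w, Finset.mem_range.mp ht]
      · simp [w]
    rw [hfun]
    refine hasSubgaussianMGF_mono hsum ?_
    have hc : ∀ t, 0 ≤ c t := fun t => mul_nonneg (zero_le_dotProduct_self (w t)) (sq_nonneg _)
    rw [← Real.toNNReal_sum_of_nonneg fun (t : Fin (T + 1)) _ => hc t]
    refine Real.toNNReal_le_toNNReal ?_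
    rw [Fin.sum_univ_eq_sum_range c, Finset.sum_range_succ]
    have hz : sigmaZ A B T σ ^ 2 =
        ∑ k ∈ Finset.range T, opNorm (A ^ k * B) ^ 2 * σ ^ 2 + σ ^ 2 :=
      Real.sq_sqrt (add_nonneg (Finset.sum_nonneg fun k _ => by positivity) (sq_nonneg σ))
    have hz0 : 0 ≤ sigmaZ A B T σ := Real.sqrt_nonneg _
    -- |a|² + |b|² = 1 bounds |a|² and |b|² by 1 separately, giving all terms of `sigmaZ`² after
    -- time reversal.
    calc ∑ t ∈ Finset.range T, c t + c T
        ≤ ∑ t ∈ Finset.range T, opNorm (A ^ (T - 1 - t) * B) ^ 2 * σ ^ 2 + σ ^ 2 := by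
          gcongr with t ht
          · have h1 := vecMul_dotProduct_vecMul_le (A ^ (T - 1 - t) * B) a
            have h2 : w t = a ᵥ* (A ^ (T - 1 - t) * B) := by simp [w, Finset.mem_range.mp ht]
            simp only [c, h2]
            gcongr
            refine h1.trans ?_
            exact mul_le_of_le_one_right (sq_nonneg _) (by linarith)
          · have h2 : w T = b := by simp [w]
            simp only [c, h2]
            exact mul_le_of_le_one_left (sq_nonneg _) (by linarith)
      _ = sigmaZ A B T σ ^ 2 := by
          rw [hz, Finset.sum_range_reflect fun k => opNorm (A ^ k * B) ^ 2 * σ ^ 2]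
      _ ≤ τ ^ 2 := by gcongr

end Excitation

end VARX

/-! ### Choice of constants and conclusion. -/

theorem corollary1 (σ γ : ℝ) (hσ : 0 < σ) (hγ : 0 < γ) :
    ∃ c₁ c₂ : ℝ, 0 < c₁ ∧ 0 < c₂ ∧
      -- i.i.d. sub-Gaussian rows
      (∀ (n m N r : ℕ) (Θstar : Matrix (Fin n ⊕ Fin m) (Fin n) ℝ)
        (Ω : Type*) [MeasurableSpace Ω] (μ : Measure Ω) [IsProbabilityMeasure μ]
        (Z : Ω → Matrix (Fin N) (Fin n ⊕ Fin m) ℝ)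
        (S : Matrix (Fin n ⊕ Fin m) (Fin n ⊕ Fin m) ℝ),
        Θstar.rank = r →
        VARX.IsRowSubGaussian Z σ μ →
        (∀ i, VARX.covMatrix (fun ω => Z ω i) μ = S) →
        γ ≤ VARX.gammaMin S →
        c₁ * (2 + 3 * (VARX.sIndex √(VARX.gammaMin S) √(VARX.gammaMax S) : ℝ))
          * ((m : ℝ) + n) * r ≤ N →
        μ.real {ω | ¬ VARX.ExactlyRecovers (Z ω * Θstar) (Z ω) Θstar} ≤ Real.exp (-c₂ * N)) ∧
      -- data produced by the linear system
      (∀ (n m N r T : ℕ) (A : Matrix (Fin n) (Fin n) ℝ) (B : Matrix (Fin n) (Fin m) ℝ)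
        (Ω : Type*) [MeasurableSpace Ω] (μ : Measure Ω) [IsProbabilityMeasure μ]
        (u : Fin N → ℕ → Ω → Fin m → ℝ) (σu : ℝ)
        (S : Matrix (Fin n ⊕ Fin m) (Fin n ⊕ Fin m) ℝ),
        (VARX.coeffMatrix A B).rank = r →
        0 < σu →
        VARX.IsExcitation u T σu μ →
        VARX.sigmaZ A B T σu ≤ σ →
        (∀ i, VARX.covMatrix
          (fun ω => VARX.measurementMatrix A B T (fun j t => u j t ω) i) μ = S) →
        γ ≤ VARX.gammaMin S →
        c₁ * (2 + 3 * (VARX.sIndex √(VARX.gammaMin S) √(VARX.gammaMax S) : ℝ))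
          * ((m : ℝ) + n) * r ≤ N →
        μ.real {ω | ¬ VARX.ExactlyRecovers
            (VARX.responseMatrix A B T (fun j t => u j t ω))
            (VARX.measurementMatrix A B T (fun j t => u j t ω))
            (VARX.coeffMatrix A B)} ≤ Real.exp (-c₂ * N)) := by
  set p := γ ^ 2 / (96 * σ ^ 4) with hp
  have hp0 : 0 < p := by positivity
  refine ⟨4 / p * (p + 4 / p), p / 2, by positivity, by positivity, ?_, ?_⟩
  · intro n m N r Θ Ω _ μ _ Z S hr hZ hS hmin hN
    refine VARX.measureReal_not_exactlyRecovers_le hσ hγ hp Θ hZ.subgaussian hZ.indep hS hmin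
      (s := VARX.sIndex √(VARX.gammaMin S) √(VARX.gammaMax S)) ?_
    rw [hr, Fintype.card_sum, Fintype.card_fin, Fintype.card_fin, Nat.cast_add, add_comm (n : ℝ)]
    exact hN
  · intro n m N r T A B Ω _ μ _ u σu S hr _ hu hσz hS hmin hN
    simp only [VARX.responseMatrix_eq]
    refine VARX.measureReal_not_exactlyRecovers_le hσ hγ hp (VARX.coeffMatrix A B)
      (hu.isSubGaussianVector_measurementMatrix A B hσz) (hu.iIndepFun_measurementMatrix A B)
      hS hmin (s := VARX.sIndex √(VARX.gammaMin S) √(VARX.gammaMax S)) ?_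
    rw [hr, Fintype.card_sum, Fintype.card_fin, Fintype.card_fin, Nat.cast_add, add_comm (n : ℝ)]
    exact hN
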